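/- Let $K$ be a field, $n\ge 0$, $S=K[x_1,\dots,x_n]$ and $\mathfrak m=(x_1,\dots,x_n)$. For an ideal $J\subseteq S$ let $\mu(J)$ be the minimal number of generators of $J$, and let $\ell(J)$ be its analytic spread, that is, the Krull dimension of the fiber ring $F(J)=\mathcal R(J)/\mathfrak m\mathcal R(J)$, where $\mathcal R(J)=\bigoplus_{k\ge 0}J^kt^k\subseteq S[t]$ is the Rees ring of $J$. Let $I\subseteq S$ be an equigenerated graded ideal, i.e. an ideal generated by homogeneous polynomials all of the same degree. Let $<$ be any monomial order on $S$, and let $I'$ be the ideal generated by the monomials of degree $d$ in the initial ideal $\operatorname{in}_<(I)$, where $d$ is the least degree with $I_d\neq 0$ (and $I'=0$ if $I=0$). Then $\ell(I')$ is finite and \[ \mu(I^2)\;\ge\;\ell(I')\,\mu(I)-\binom{\ell(I')}{2}. \] If moreover $I$ is a monomial ideal, then $\ell(I)$ is finite and \[ \mu(I^2)\;\ge\;\ell(I)\,\mu(I)-\binom{\ell(I)}{2}. \] -/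

import Mathlib

open MvPolynomial

noncomputable section

namespace FiberRing

universe u

variable {K : Type u} [Field K] {n : ℕ}

/-- The minimal number `μ(I)` of generators of an ideal. (The polynomial ring is Noetherian, so
this is the cardinality of a smallest generating set.) -/
def mu (I : Ideal (MvPolynomial (Fin n) K)) : ℕ :=
  Submodule.spanFinrank I

/-- `I` is an equigenerated graded ideal: it is generated by homogeneous polynomials, all of the
same degree `d`. -/
def IsEquigenerated (I : Ideal (MvPolynomial (Fin n) K)) : Prop :=
  ∃ (d : ℕ) (G : Set (MvPolynomial (Fin n) K)), (∀ f ∈ G, f.IsHomogeneous d) ∧ I = Ideal.span G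

/-- `I` is a monomial ideal: it is generated by monomials. -/
def IsMonomialIdeal (I : Ideal (MvPolynomial (Fin n) K)) : Prop :=
  ∃ A : Set (Fin n →₀ ℕ), I = Ideal.span ((fun a => monomial a (1 : K)) '' A)

/-- The graded maximal ideal `𝔪 = (x₁, …, xₙ)`. -/
def gradedMaximalIdeal (K : Type u) [Field K] (n : ℕ) : Ideal (MvPolynomial (Fin n) K) :=
  Ideal.span (Set.range X)

/-- The fiber ring `F(I) = R(I) / 𝔪 R(I)`, where `R(I) = ⨁ₖ Iᵏ tᵏ ⊆ S[t]` is the Rees ring. -/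
abbrev Fiber (I : Ideal (MvPolynomial (Fin n) K)) : Type u :=
  reesAlgebra I ⧸
    (gradedMaximalIdeal K n).map (algebraMap (MvPolynomial (Fin n) K) (reesAlgebra I))

/-- The analytic spread `ℓ(I)`: the Krull dimension of the fiber ring. -/
def analyticSpread (I : Ideal (MvPolynomial (Fin n) K)) : WithBot ℕ∞ :=
  ringKrullDim (Fiber I)

/-- The initial ideal of `L` with respect to a monomial order: the ideal generated by the leading
monomials of the nonzero elements of `L`. -/
def initialIdeal (m : MonomialOrder (Fin n)) (L : Ideal (MvPolynomial (Fin n) K)) :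
    Ideal (MvPolynomial (Fin n) K) :=
  Ideal.span {p | ∃ f ∈ L, f ≠ 0 ∧ p = monomial (m.degree f) (1 : K)}

/-- The initial degree of a graded ideal `L ≠ 0`: the `d` with `L_d ≠ 0` and `L_i = 0` for `i < d`.
(The value is `0` for `L = 0`.) -/
def initialDegree (L : Ideal (MvPolynomial (Fin n) K)) : ℕ :=
  sInf {i | ∃ f ∈ L, f ≠ 0 ∧ f.IsHomogeneous i}

/-- The ideal `L'` generated by the monomials of degree `d` in the initial ideal of `L`, where `d`
is the initial degree of `L`. -/
def initialDegreePart (m : MonomialOrder (Fin n)) (L : Ideal (MvPolynomial (Fin n) K)) :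
    Ideal (MvPolynomial (Fin n) K) :=
  Ideal.span {p | ∃ a : Fin n →₀ ℕ, a.degree = initialDegree L ∧
    p = monomial a (1 : K) ∧ p ∈ initialIdeal m L}

end FiberRing

end

/-! Let `A` be the set of leading exponents of the forms of degree `d` in `I`, where `I` is
generated in degree `d`. Reduction by leading terms gives `μ(I) ≤ |A|`. Products of forms realise
every exponent of `A + A` as a leading exponent in degree `2d` of `I²`, so `|A + A| ≤ μ(I²)`. Let
`r` be the rank of the vectors `(1, a)`, `a ∈ A`. Freiman's lemma gives `r|A| - C(r,2) ≤ |A + A|`.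
The ideal `I'` is generated by the monomials `x^a`, `a ∈ A`, and its fiber ring by the classes of
`x^a t`. These satisfy every binomial relation that holds among the vectors `(1, a)`, whence `ℓ(I')
≤ r`. Only this inequality is needed, because the Freiman bound increases with the rank up to `|A|`.
An equigenerated monomial ideal satisfies `I' = I`. -/

/-! ### Freiman's lemma on sumsets. -/

open scoped Pointwise in
/-- **Freiman's lemma**, with the dimension replaced by the rank of a family of vectors `f` that
respects additive quadruples. -/
theorem finrank_mul_card_le_card_add_self {G V : Type*} [AddCommMonoid G] [LinearOrder G]
    [IsOrderedCancelAddMonoid G] [AddCommGroup V] [Module ℚ V] [FiniteDimensional ℚ V] (f : G → V)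
    (hf : ∀ a b c e, a + b = c + e → f a + f b = f c + f e) (A : Finset G) :
    Module.finrank ℚ (Submodule.span ℚ (f '' A)) * A.card ≤
      (A + A).card + (Module.finrank ℚ (Submodule.span ℚ (f '' A))).choose 2 := by
  classical
  induction A using Finset.induction_on_max with
  | empty => simp
  | insert a A ha ih =>
    have haA : a ∉ A := fun h => lt_irrefl _ (ha a h)
    -- Since `a` exceeds all of `A`, the growth of the sumset is measured by the `b` for which `a +
    -- b` is new.
    set C := (insert a A).filter (fun b => a + b ∉ A + A) with hC
    have hdisj : Disjoint (A + A) (C.image (a + ·)) := by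
      rw [Finset.disjoint_left]
      intro x hx hx'
      obtain ⟨b, hb, rfl⟩ := Finset.mem_image.1 hx'
      exact (Finset.mem_filter.1 hb).2 hx
    have hsub : (A + A) ∪ C.image (a + ·) ⊆ insert a A + insert a A := by
      refine Finset.union_subset
        (Finset.add_subset_add (Finset.subset_insert _ _) (Finset.subset_insert _ _)) ?_
      intro x hx
      obtain ⟨b, hb, rfl⟩ := Finset.mem_image.1 hx
      exact Finset.add_mem_add (Finset.mem_insert_self _ _) (Finset.mem_filter.1 hb).1
    have hcard : (A + A).card + C.card ≤ (insert a A + insert a A).card := by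
      have := Finset.card_le_card hsub
      rwa [Finset.card_union_of_disjoint hdisj,
        Finset.card_image_of_injective _ (add_right_injective a)] at this
    have haC : a ∈ C := by
      refine Finset.mem_filter.2 ⟨Finset.mem_insert_self _ _, fun h => ?_⟩
      obtain ⟨b, hb, c, hc, h⟩ := Finset.mem_add.1 h
      exact (add_lt_add (ha b hb) (ha c hc)).ne h
    set W := Submodule.span ℚ (f '' (A : Set G)) with hW
    have hins : f '' ((insert a A : Finset G) : Set G) = insert (f a) (f '' A) := by
      rw [Finset.coe_insert, Set.image_insert_eq]
    have : FiniteDimensional ℚ W :=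
      FiniteDimensional.span_of_finite ℚ (A.finite_toSet.image f)
    rw [Finset.card_insert_of_notMem haA]
    by_cases hmem : f a ∈ W
    · have hWW : Submodule.span ℚ (f '' ((insert a A : Finset G) : Set G)) = W := by
        rw [hins, Submodule.span_insert_eq_span hmem]
      rw [hWW]
      -- The new sums number at least the rank, since `f '' C` spans everything. A largest `b`
      -- violating this has `a + b = c + e` with `c, e < a`, which forces `c, e > b`; then `f b = f
      -- c + f e - f a` lies in the span after all.
      have hCspan : ∀ b ∈ insert a A, f b ∈ Submodule.span ℚ (f '' (C : Set G)) := by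
        by_contra! hcon
        obtain ⟨b₀, hb₀, hb₀'⟩ := hcon
        set D := (insert a A).filter (fun b => f b ∉ Submodule.span ℚ (f '' (C : Set G)))
        have hD : D.Nonempty := ⟨b₀, Finset.mem_filter.2 ⟨hb₀, hb₀'⟩⟩
        obtain ⟨hb, hb'⟩ := Finset.mem_filter.1 (D.max'_mem hD)
        have hup : ∀ c ∈ A, D.max' hD < c → f c ∈ Submodule.span ℚ (f '' (C : Set G)) := by
          intro c hc hlt
          by_contra hc'
          exact (D.le_max' c (Finset.mem_filter.2
            ⟨Finset.mem_insert_of_mem hc, hc'⟩)).not_gt hlt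
        generalize D.max' hD = b at *
        have hbC : b ∉ C := fun h => hb' (Submodule.subset_span ⟨b, h, rfl⟩)
        have : a + b ∈ A + A := by
          by_contra h
          exact hbC (Finset.mem_filter.2 ⟨hb, h⟩)
        obtain ⟨c, hc, e, he, hce⟩ := Finset.mem_add.1 this
        have hbe : b < e := by
          by_contra! h
          exact (add_lt_add_of_lt_of_le (ha c hc) h).ne hce
        have hbc : b < c := by
          by_contra! h
          exact (add_lt_add_of_le_of_lt h (ha e he)).ne (by rw [hce, add_comm])
        have key : f b = f c + f e - f a := by
          rw [hf _ _ _ _ hce]; abel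
        exact hb' (key ▸ Submodule.sub_mem _ (Submodule.add_mem _ (hup c hc hbc) (hup e he hbe))
          (Submodule.subset_span ⟨a, haC, rfl⟩))
      have hle : W ≤ Submodule.span ℚ (f '' (C : Set G)) := by
        rw [hW, Submodule.span_le]
        rintro _ ⟨b, hb, rfl⟩
        exact hCspan b (Finset.mem_insert_of_mem hb)
      have : FiniteDimensional ℚ (Submodule.span ℚ (f '' (C : Set G))) :=
        FiniteDimensional.span_of_finite ℚ (C.finite_toSet.image f)
      have hlC : Module.finrank ℚ W ≤ C.card := by
        refine (Submodule.finrank_mono hle).trans ?_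
        rw [← Finset.coe_image]
        exact (finrank_span_finset_le_card _).trans Finset.card_image_le
      rw [mul_add, mul_one]
      omega
    · have hrank : Module.finrank ℚ
          (Submodule.span ℚ (f '' ((insert a A : Finset G) : Set G))) =
          Module.finrank ℚ W + 1 := by
        rw [hins, Submodule.span_insert, sup_comm]
        exact Submodule.finrank_sup_span_singleton hmem
      -- When `a` raises the rank, every sum `a + b` is new: an old one would express `f a` through
      -- `f '' A`.
      have hCall : C = insert a A := by
        refine Finset.filter_true_of_mem fun b hb h => ?_
        rcases Finset.mem_insert.1 hb with rfl | hb
        · exact (Finset.mem_filter.1 haC).2 h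
        · obtain ⟨c, hc, e, he, hce⟩ := Finset.mem_add.1 h
          have key : f a = f c + f e - f b := by
            rw [hf _ _ _ _ hce]; abel
          exact hmem (key ▸ Submodule.sub_mem _ (Submodule.add_mem _
            (Submodule.subset_span ⟨c, hc, rfl⟩) (Submodule.subset_span ⟨e, he, rfl⟩))
            (Submodule.subset_span ⟨b, hb, rfl⟩))
      rw [hCall, Finset.card_insert_of_notMem haA] at hcard
      -- As `C(r+1,2) = C(r,2) + r`, the bound grows by exactly `|A| + 1`, the number of new sums.
      rw [hrank, Nat.choose_succ_succ' _ 1, Nat.choose_one_right]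
      nlinarith

/-- The Freiman bound `l * N - l.choose 2` is monotone in `l` for `l ≤ N`. -/
theorem mul_add_choose_two_le {l r N : ℕ} (hlr : l ≤ r) (hrN : r ≤ N) :
    l * N + r.choose 2 ≤ r * N + l.choose 2 := by
  induction r, hlr using Nat.le_induction with
  | base => rfl
  | succ r hlr ih =>
    have := ih (by omega)
    rw [Nat.choose_succ_succ' _ 1, Nat.choose_one_right]
    nlinarith

/-! ### Krull dimension and binomial relations. -/

/-- Linear independence over `ℚ` may be tested on relations with natural coefficients. -/
theorem linearIndependent_rat_of_nat {ι V : Type*} [AddCommGroup V] [Module ℚ V] {v : ι → V}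
    (h : LinearIndependent ℕ v) : LinearIndependent ℚ v := by
  rw [← LinearIndependent.iff_fractionRing ℤ ℚ, linearIndependent_iff']
  intro s g hg i hi
  -- Positive and negative parts of an integer relation go to opposite sides.
  have h1 : ∑ j ∈ s, (g j).toNat • v j = ∑ j ∈ s, (-g j).toNat • v j := by
    rw [← sub_eq_zero, ← Finset.sum_sub_distrib, ← hg]
    refine Finset.sum_congr rfl fun j _ => ?_
    rw [← natCast_zsmul, ← natCast_zsmul, ← sub_smul]
    congr 1
    omega
  have := linearIndependent_iff'ₛ.1 h s _ _ h1 i hi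
  omega

/-- An integral extension of rings does not increase the Krull dimension. -/
theorem ringKrullDim_le_of_isIntegral {R S : Type*} [CommRing R] [CommRing S] [Algebra R S]
    [Algebra.IsIntegral R S] : ringKrullDim S ≤ ringKrullDim R := by
  refine Order.krullDim_le_of_strictMono (PrimeSpectrum.comap (algebraMap R S)) fun p q hpq => ?_
  have hpq' : p.asIdeal < q.asIdeal := hpq
  exact Ideal.IsIntegral.comap_lt_comap hpq'

/-- The Krull dimension of a finitely generated domain over a field is at most the cardinality of
any transcendence basis. -/
theorem ringKrullDim_le_card_of_isTranscendenceBasis {K F : Type*} [Field K] [CommRing F]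
    [IsDomain F] [Algebra K F] [Algebra.FiniteType K F] {ι : Type*} [Finite ι] {x : ι → F}
    (hx : IsTranscendenceBasis K x) : ringKrullDim F ≤ Nat.card ι := by
  -- By Noether normalization the dimension is at most `s`, and the `s` variables stay algebraically
  -- independent in `F`.
  obtain ⟨s, g, hinj, hgint⟩ := exists_integral_inj_algHom_of_fg K F
  algebraize [g.toRingHom]
  have h1 : ringKrullDim F ≤ ringKrullDim (MvPolynomial (Fin s) K) :=
    have : Algebra.IsIntegral (MvPolynomial (Fin s) K) F := ⟨hgint⟩
    ringKrullDim_le_of_isIntegral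
  refine h1.trans ?_
  rw [MvPolynomial.ringKrullDim_of_isNoetherianRing, ringKrullDim_eq_zero_of_field, zero_add,
    Nat.card_fin]
  have hind : AlgebraicIndependent K (fun i : Fin s => g (X i)) := by
    have : MvPolynomial.aeval (fun i : Fin s => g (X i)) = g := by ext; simp
    rw [AlgebraicIndependent, this]
    exact hinj
  have h2 := hind.lift_cardinalMk_le_trdeg
  have h3 := hx.lift_cardinalMk_eq_trdeg
  have h4 : Cardinal.toNat (Algebra.trdeg K F) = Nat.card ι := by
    have := congrArg Cardinal.toNat h3
    simpa [Cardinal.toNat_lift, Nat.card] using this.symm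
  have hfin : Algebra.trdeg K F < Cardinal.aleph0 := by
    rw [← Cardinal.lift_lt_aleph0, ← h3, Cardinal.lift_lt_aleph0]
    exact Cardinal.lt_aleph0_of_finite ι
  have h5 : s ≤ Nat.card ι := by
    rw [← h4]
    have := Cardinal.toNat_le_toNat h2 (by simpa using hfin)
    simpa using this
  exact_mod_cast h5

/-- A domain generated over a field by finitely many elements satisfying all binomial relations
among the monomials with exponents `e i` has Krull dimension at most the rank of the `e i`. -/
theorem ringKrullDim_le_finrank_of_isDomain {K F ι V : Type*} [Field K] [CommRing F]
    [IsDomain F] [Algebra K F] [AddCommGroup V] [Module ℚ V] [Finite ι] (y : ι → F) (e : ι → V)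
    (hy : Algebra.adjoin K (Set.range y) = ⊤)
    (h : ∀ u v : ι →₀ ℕ, u.sum (fun i k => k • e i) = v.sum (fun i k => k • e i) →
      u.prod (fun i k => y i ^ k) = v.prod (fun i k => y i ^ k)) :
    ringKrullDim F ≤ Module.finrank ℚ (Submodule.span ℚ (Set.range e)) := by
  have : Algebra.FiniteType K F :=
    ⟨Subalgebra.fg_def.2 ⟨_, Set.finite_range y, hy⟩⟩
  have : Algebra.IsAlgebraic (Algebra.adjoin K (Set.range y)) F := by
    rw [hy]
    exact ⟨fun x => isAlgebraic_algebraMap (⟨x, trivial⟩ : (⊤ : Subalgebra K F))⟩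
  obtain ⟨t, hts, ht⟩ := exists_isTranscendenceBasis_subset (R := K) (Set.range y)
  have : Finite t := ((Set.finite_range y).subset hts).to_subtype
  refine (ringKrullDim_le_card_of_isTranscendenceBasis ht).trans ?_
  choose σ hσ using fun a : t => hts a.2
  have hσinj : Function.Injective σ := fun a b hab => Subtype.ext (by rw [← hσ, ← hσ, hab])
  -- A relation with natural coefficients would, by `h`, equate two monomials in algebraically
  -- independent elements.
  have hli : LinearIndependent ℚ (fun a : t => e (σ a)) := by
    refine linearIndependent_rat_of_nat fun u v huv => ?_
    have huv' := h (u.mapDomain σ) (v.mapDomain σ) (by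
      rw [Finsupp.sum_mapDomain_index (by simp) (by simp [add_smul]),
        Finsupp.sum_mapDomain_index (by simp) (by simp [add_smul])]
      exact huv)
    rw [Finsupp.prod_mapDomain_index (by simp) (by simp [pow_add]),
      Finsupp.prod_mapDomain_index (by simp) (by simp [pow_add])] at huv'
    simp only [hσ] at huv'
    have := ht.1 (a₁ := monomial u (1 : K)) (a₂ := monomial v (1 : K)) (by
      simpa [aeval_monomial] using huv')
    exact monomial_left_injective one_ne_zero this
  have : FiniteDimensional ℚ (Submodule.span ℚ (Set.range e)) :=
    FiniteDimensional.span_of_finite ℚ (Set.finite_range e)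
  have := Fintype.ofFinite t
  have hle : Fintype.card t ≤ Module.finrank ℚ (Submodule.span ℚ (Set.range e)) := by
    rw [← finrank_span_eq_card hli]
    refine Submodule.finrank_mono (Submodule.span_mono ?_)
    rintro _ ⟨a, rfl⟩
    exact ⟨σ a, rfl⟩
  rw [Nat.card_eq_fintype_card]
  exact_mod_cast hle

/-- The same bound without the assumption that the ring is a domain. -/
theorem ringKrullDim_le_finrank {K F ι V : Type*} [Field K] [CommRing F]
    [Algebra K F] [AddCommGroup V] [Module ℚ V] [Finite ι] (y : ι → F) (e : ι → V)
    (hy : Algebra.adjoin K (Set.range y) = ⊤)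
    (h : ∀ u v : ι →₀ ℕ, u.sum (fun i k => k • e i) = v.sum (fun i k => k • e i) →
      u.prod (fun i k => y i ^ k) = v.prod (fun i k => y i ^ k)) :
    ringKrullDim F ≤ Module.finrank ℚ (Submodule.span ℚ (Set.range e)) := by
  refine iSup_le fun c => ?_
  -- Each chain of primes lives over its smallest member `P`, so its length is bounded by the
  -- dimension of the domain `F ⧸ P`.
  let P := c.head.asIdeal
  have hdom : ringKrullDim (F ⧸ P) ≤ Module.finrank ℚ (Submodule.span ℚ (Set.range e)) := by
    refine ringKrullDim_le_finrank_of_isDomain (K := K)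
      (fun i => Ideal.Quotient.mkₐ K P (y i)) e ?_ fun u v huv => ?_
    · have := congrArg (Subalgebra.map (Ideal.Quotient.mkₐ K P)) hy
      rw [AlgHom.map_adjoin, ← Set.range_comp, Algebra.map_top,
        (AlgHom.range_eq_top _).2 (Ideal.Quotient.mkₐ_surjective K P)] at this
      exact this
    · have := congrArg (Ideal.Quotient.mkₐ K P) (h u v huv)
      simpa [Finsupp.prod] using this
  refine le_trans ?_ hdom
  rw [ringKrullDim_quotient]
  let c' : LTSeries (PrimeSpectrum.zeroLocus (R := F) (P : Set F)) :=
    { length := c.length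
      toFun := fun i => ⟨c i, fun x hx => c.head_le i hx⟩
      step := fun i => c.step i }
  exact le_iSup (fun q : LTSeries (PrimeSpectrum.zeroLocus (R := F) (P : Set F)) =>
    (q.length : WithBot ℕ∞)) c'

namespace FiberRing

universe u

variable {K : Type u} [Field K] {n : ℕ}

/-! ### Forms of least degree and numbers of generators. -/

/-- If all terms of `f` have degree at least `d`, then the part of degree `d` of `c * f` is a
scalar multiple of that of `f`. -/
theorem homogeneousComponent_mul_of_coeff_eq_zero {d : ℕ} {f : MvPolynomial (Fin n) K}
    (hf : ∀ a : Fin n →₀ ℕ, a.degree < d → f.coeff a = 0) (c : MvPolynomial (Fin n) K) :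
    homogeneousComponent d (c * f) = c.coeff 0 • homogeneousComponent d f := by
  ext a
  rw [coeff_smul, coeff_homogeneousComponent, coeff_homogeneousComponent]
  split_ifs with ha
  · rw [coeff_mul, Finset.sum_eq_single (0, a), smul_eq_mul]
    · rintro ⟨x, y⟩ hxy hne
      have hxy' : x + y = a := Finset.HasAntidiagonal.mem_antidiagonal.1 hxy
      have hx : x.degree ≠ 0 := by
        intro h0
        have hx0 : x = 0 := (Finsupp.degree_eq_zero_iff _).1 h0
        subst hx0
        exact hne (by rw [← hxy', zero_add])
      have hdeg : x.degree + y.degree = a.degree := by rw [← hxy', map_add]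
      rw [hf y (by omega), mul_zero]
    · intro h
      exact absurd (Finset.HasAntidiagonal.mem_antidiagonal.2 (zero_add a)) h
  · simp

/-- Elements of an ideal generated in degree `d` have no terms of degree less than `d`, and their
part of degree `d` lies in the ideal. -/
theorem coeff_eq_zero_and_homogeneousComponent_mem {d : ℕ} {G : Set (MvPolynomial (Fin n) K)}
    (hG : ∀ f ∈ G, f.IsHomogeneous d) {f : MvPolynomial (Fin n) K} (hf : f ∈ Ideal.span G) :
    (∀ a : Fin n →₀ ℕ, a.degree < d → f.coeff a = 0) ∧
      homogeneousComponent d f ∈ Ideal.span G := by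
  induction hf using Submodule.span_induction with
  | mem f hf =>
    refine ⟨fun a ha => (hG f hf).coeff_eq_zero ha.ne, ?_⟩
    rw [homogeneousComponent_eq_self (hG f hf)]
    exact Ideal.subset_span hf
  | zero => simp
  | add f g _ _ hf hg =>
    refine ⟨fun a ha => by rw [coeff_add, hf.1 a ha, hg.1 a ha, add_zero], ?_⟩
    rw [map_add]
    exact Ideal.add_mem _ hf.2 hg.2
  | smul c f _ hf =>
    refine ⟨fun a ha => ?_, ?_⟩
    · rw [smul_eq_mul, coeff_mul]
      refine Finset.sum_eq_zero fun x hx => ?_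
      have hx' : x.1 + x.2 = a := Finset.HasAntidiagonal.mem_antidiagonal.1 hx
      have hdeg : x.1.degree + x.2.degree = a.degree := by rw [← hx', map_add]
      rw [hf.1 x.2 (by omega), mul_zero]
    · rw [smul_eq_mul, homogeneousComponent_mul_of_coeff_eq_zero hf.1, smul_eq_C_mul]
      exact Ideal.mul_mem_left _ _ hf.2

/-- Linearly independent forms of degree `d` in an ideal generated in degree `d` bound the number
of generators from below. -/
theorem card_le_mu {d : ℕ} {G : Set (MvPolynomial (Fin n) K)}
    (hG : ∀ f ∈ G, f.IsHomogeneous d) {ι : Type*} [Fintype ι] {v : ι → MvPolynomial (Fin n) K}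
    (hv : LinearIndependent K v) (hvd : ∀ i, (v i).IsHomogeneous d)
    (hvG : ∀ i, v i ∈ Ideal.span G) : Fintype.card ι ≤ mu (Ideal.span G) := by
  classical
  obtain ⟨s, hs, hspan⟩ := Submodule.FG.exists_span_finset_card_eq_spanFinrank
    (IsNoetherian.noetherian (Ideal.span G))
  rw [mu, ← hs]
  -- The minimal generators need not be homogeneous. Their components of degree `d` still span all
  -- those of the ideal over `K`, because a multiplier acts there through its constant term.
  set W := Submodule.span K (s.image (homogeneousComponent d) : Set (MvPolynomial (Fin n) K))
  have hW : ∀ f ∈ Ideal.span G, homogeneousComponent d f ∈ W := by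
    intro f hf
    rw [← hspan] at hf
    induction hf using Submodule.span_induction with
    | mem f hf => exact Submodule.subset_span (by simpa using ⟨f, hf, rfl⟩)
    | zero => simp
    | add f g _ _ hf hg => rw [map_add]; exact W.add_mem hf hg
    | smul c f hf ih =>
      rw [smul_eq_mul, homogeneousComponent_mul_of_coeff_eq_zero
        (coeff_eq_zero_and_homogeneousComponent_mem hG (hspan ▸ hf)).1]
      exact W.smul_mem _ ih
  have hle : Submodule.span K (Set.range v) ≤ W := by
    rw [Submodule.span_le]
    rintro _ ⟨i, rfl⟩
    rw [← homogeneousComponent_eq_self (hvd i)]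
    exact hW _ (hvG i)
  rw [← finrank_span_eq_card hv]
  exact (Submodule.finrank_mono hle).trans
    ((finrank_span_finset_le_card _).trans Finset.card_image_le)

/-- Nonzero polynomials with pairwise distinct leading exponents are linearly independent. -/
theorem linearIndependent_of_injective_degree (m : MonomialOrder (Fin n)) {ι : Type*}
    {v : ι → MvPolynomial (Fin n) K} (h0 : ∀ i, v i ≠ 0)
    (hinj : Function.Injective fun i => m.degree (v i)) : LinearIndependent K v := by
  classical
  rw [linearIndependent_iff']
  intro s g hg
  by_contra! hcon
  obtain ⟨i, hi, hgi⟩ := hcon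
  obtain ⟨j, hj, hmax⟩ := (s.filter fun i => g i ≠ 0).exists_max_image
    (fun i => m.toSyn (m.degree (v i))) ⟨i, Finset.mem_filter.2 ⟨hi, hgi⟩⟩
  obtain ⟨hjs, hgj⟩ := Finset.mem_filter.1 hj
  have hc := congrArg (coeff (m.degree (v j))) hg
  rw [coeff_sum, Finset.sum_eq_single j, coeff_smul, coeff_zero, smul_eq_mul, mul_eq_zero] at hc
  · exact hc.elim hgj (m.coeff_degree_ne_zero_iff.2 (h0 j))
  · intro k hk hkj
    rw [coeff_smul]
    by_cases hgk : g k = 0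
    · simp [hgk]
    · have hle := hmax k (Finset.mem_filter.2 ⟨hk, hgk⟩)
      have hlt : m.toSyn (m.degree (v k)) < m.toSyn (m.degree (v j)) :=
        lt_of_le_of_ne hle fun h => hkj (hinj (m.toSyn.injective h))
      rw [m.coeff_eq_zero_of_lt hlt, smul_zero]
  · exact fun h => absurd hjs h

/-! ### Leading exponents in the generating degree. -/

/-- The exponents of the leading monomials of the forms of degree `d` in `I`. -/
def leadingExponents (m : MonomialOrder (Fin n)) (I : Ideal (MvPolynomial (Fin n) K)) (d : ℕ) :
    Set (Fin n →₀ ℕ) :=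
  {a | ∃ f ∈ I, f ≠ 0 ∧ f.IsHomogeneous d ∧ m.degree f = a}

theorem degree_eq_of_mem_leadingExponents {m : MonomialOrder (Fin n)}
    {I : Ideal (MvPolynomial (Fin n) K)} {d : ℕ} {a : Fin n →₀ ℕ}
    (ha : a ∈ leadingExponents m I d) : a.degree = d := by
  obtain ⟨f, -, hf0, hfd, rfl⟩ := ha
  by_contra h
  exact m.coeff_degree_ne_zero_iff.2 hf0 (hfd.coeff_eq_zero h)

theorem finite_leadingExponents (m : MonomialOrder (Fin n))
    (I : Ideal (MvPolynomial (Fin n) K)) (d : ℕ) : (leadingExponents m I d).Finite := by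
  refine (Finset.finite_toSet (Finset.finsuppAntidiag Finset.univ d)).subset fun a ha => ?_
  have := degree_eq_of_mem_leadingExponents ha
  simpa [Finsupp.degree_eq_sum] using this

/-- An ideal generated in degree `d` has at most as many generators as there are leading exponents
of its forms of degree `d`. -/
theorem mu_le_ncard_leadingExponents (m : MonomialOrder (Fin n)) {d : ℕ}
    {G : Set (MvPolynomial (Fin n) K)} (hG : ∀ f ∈ G, f.IsHomogeneous d) :
    mu (Ideal.span G) ≤ (leadingExponents m (Ideal.span G) d).ncard := by
  set A := leadingExponents m (Ideal.span G) d with hA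
  have hfin := finite_leadingExponents m (Ideal.span G) d
  choose! F hFI hF0 hFd hFdeg using fun a (ha : a ∈ A) => ha
  -- Well-founded induction on the leading exponent: subtracting a multiple of `F a` cancels the
  -- leading term and stays within the forms of degree `d` of the ideal.
  have hgen : ∀ (k : m.syn) (f : MvPolynomial (Fin n) K), m.toSyn (m.degree f) = k →
      f ∈ Ideal.span G → f.IsHomogeneous d → f ∈ Ideal.span (F '' A) := by
    intro k
    induction k using WellFoundedLT.induction with
    | ind k ih =>
      intro f hk hf hfd
      by_cases hf0 : f = 0
      · rw [hf0]; exact Ideal.zero_mem _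
      have ha : m.degree f ∈ A := ⟨f, hf, hf0, hfd, rfl⟩
      set a := m.degree f with ha_def
      set c := f.coeff a / (F a).coeff a
      have hFa : (F a).coeff a ≠ 0 := by
        have := m.coeff_degree_ne_zero_iff.2 (hF0 a ha)
        rwa [hFdeg a ha] at this
      have hmem : c • F a ∈ Ideal.span (F '' A) := by
        rw [smul_eq_C_mul]
        exact Ideal.mul_mem_left _ _ (Ideal.subset_span ⟨a, ha, rfl⟩)
      have hsub : f - c • F a ∈ Ideal.span (F '' A) := by
        by_cases hz : f - c • F a = 0
        · rw [hz]; exact Ideal.zero_mem _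
        refine ih _ ?_ _ rfl ?_ ?_
        · have hle : m.toSyn (m.degree (f - c • F a)) ≤ m.toSyn a := by
            refine m.degree_sub_le.trans (sup_le le_rfl (m.degree_smul_le.trans ?_))
            rw [hFdeg a ha]
          refine hk ▸ lt_of_le_of_ne hle fun heq => ?_
          have hne := m.coeff_degree_ne_zero_iff.2 hz
          rw [m.toSyn.injective heq] at hne
          apply hne
          rw [coeff_sub, coeff_smul, smul_eq_mul, div_mul_cancel₀ _ hFa, sub_self]
        · refine Ideal.sub_mem _ hf ?_
          rw [smul_eq_C_mul]
          exact Ideal.mul_mem_left _ _ (hFI a ha)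
        · refine hfd.sub ?_
          rw [smul_eq_C_mul]
          simpa using (isHomogeneous_C (Fin n) c).mul (hFd a ha)
      simpa using Ideal.add_mem _ hsub hmem
  have hspan : Ideal.span G = Ideal.span (F '' A) := by
    refine le_antisymm (Ideal.span_le.2 fun f hf =>
      hgen _ f rfl (Ideal.subset_span hf) (hG f hf)) (Ideal.span_le.2 ?_)
    rintro _ ⟨a, ha, rfl⟩
    exact hFI a ha
  rw [mu, hspan]
  exact (Submodule.spanFinrank_span_le_ncard_of_finite (hfin.image F)).trans
    (Set.ncard_image_le hfin)

open scoped Pointwise in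
/-- The sums of two leading exponents of an ideal generated in degree `d` bound the number of
generators of its square from below. -/
theorem ncard_leadingExponents_add_le_mu (m : MonomialOrder (Fin n)) {d : ℕ}
    {G : Set (MvPolynomial (Fin n) K)} (hG : ∀ f ∈ G, f.IsHomogeneous d) :
    (leadingExponents m (Ideal.span G) d + leadingExponents m (Ideal.span G) d).ncard ≤
      mu (Ideal.span G ^ 2) := by
  set A := leadingExponents m (Ideal.span G) d with hA
  have hfin : (A + A).Finite :=
    (finite_leadingExponents m (Ideal.span G) d).add (finite_leadingExponents m (Ideal.span G) d)
  have hex : ∀ b : ↥(A + A), ∃ f ∈ Ideal.span G ^ 2, f ≠ 0 ∧ f.IsHomogeneous (d + d) ∧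
      m.degree f = b := by
    rintro ⟨_, _, ⟨f, hf, hf0, hfd, rfl⟩, _, ⟨g, hg, hg0, hgd, rfl⟩, rfl⟩
    exact ⟨f * g, by rw [pow_two]; exact Ideal.mul_mem_mul hf hg, mul_ne_zero hf0 hg0,
      hfd.mul hgd, m.degree_mul hf0 hg0⟩
  choose v hvI hv0 hvd hvdeg using hex
  have hli : LinearIndependent K v := by
    refine linearIndependent_of_injective_degree m hv0 fun a b hab => Subtype.ext ?_
    simpa only [hvdeg] using hab
  have hsq : Ideal.span G ^ 2 = Ideal.span (G * G) := by
    rw [pow_two, Ideal.span_mul_span']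
  have hGG : ∀ f ∈ G * G, f.IsHomogeneous (d + d) := by
    rintro _ ⟨f, hf, g, hg, rfl⟩
    exact (hG f hf).mul (hG g hg)
  have := hfin.fintype
  have hle := card_le_mu hGG hli hvd fun i => hsq ▸ hvI i
  rwa [← hsq, ← Nat.card_eq_fintype_card, Nat.card_coe_set_eq] at hle

/-- The ideal generated by the monomials of least degree in the initial ideal of an ideal
generated in degree `d` is generated by the leading monomials of its forms of degree `d`. -/
theorem initialDegreePart_span (m : MonomialOrder (Fin n)) {d : ℕ}
    {G : Set (MvPolynomial (Fin n) K)} (hG : ∀ f ∈ G, f.IsHomogeneous d) :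
    initialDegreePart m (Ideal.span G) = Ideal.span
      ((fun a => monomial a (1 : K)) '' leadingExponents m (Ideal.span G) d) := by
  have hin : initialIdeal m (Ideal.span G) = Ideal.span ((fun a => monomial a (1 : K)) ''
      {a | ∃ f ∈ Ideal.span G, f ≠ 0 ∧ m.degree f = a}) := by
    rw [initialIdeal]
    congr 1
    ext p
    constructor
    · rintro ⟨f, hf, hf0, rfl⟩
      exact ⟨_, ⟨f, hf, hf0, rfl⟩, rfl⟩
    · rintro ⟨_, ⟨f, hf, hf0, rfl⟩, rfl⟩
      exact ⟨f, hf, hf0, rfl⟩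
  have hmem : ∀ a : Fin n →₀ ℕ, monomial a (1 : K) ∈ initialIdeal m (Ideal.span G) ↔
      ∃ f ∈ Ideal.span G, f ≠ 0 ∧ m.degree f ≤ a := by
    intro a
    classical
    rw [hin, mem_ideal_span_monomial_image]
    simp only [support_monomial, one_ne_zero, if_false, Finset.mem_singleton, forall_eq]
    constructor
    · rintro ⟨_, ⟨f, hf, hf0, rfl⟩, hle⟩
      exact ⟨f, hf, hf0, hle⟩
    · rintro ⟨f, hf, hf0, hle⟩
      exact ⟨_, ⟨f, hf, hf0, rfl⟩, hle⟩
  have hlow : ∀ f ∈ Ideal.span G, f ≠ 0 → d ≤ (m.degree f).degree := by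
    intro f hf hf0
    by_contra! h
    exact m.coeff_degree_ne_zero_iff.2 hf0
      ((coeff_eq_zero_and_homogeneousComponent_mem hG hf).1 _ h)
  -- A nonzero `f` is required: for the zero ideal `d` is arbitrary while `initialDegree` defaults
  -- to `0`.
  have hdeg : ∀ f ∈ Ideal.span G, f ≠ 0 → initialDegree (Ideal.span G) = d := by
    intro f hf hf0
    have hd : d ∈ {i | ∃ f ∈ Ideal.span G, f ≠ 0 ∧ f.IsHomogeneous i} := by
      by_contra h
      refine hf0 ((Ideal.mem_bot).1 ?_)
      rw [← Ideal.span_eq_bot.2 fun g hg => by_contra fun hg0 =>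
        h ⟨g, Ideal.subset_span hg, hg0, hG g hg⟩]
      exact hf
    refine le_antisymm (Nat.sInf_le hd) ?_
    · obtain ⟨g, hg, hg0, hgd⟩ := Nat.sInf_mem ⟨d, hd⟩
      have h1 := hlow g hg hg0
      have h2 : (m.degree g).degree = initialDegree (Ideal.span G) := by
        by_contra h
        exact m.coeff_degree_ne_zero_iff.2 hg0 (hgd.coeff_eq_zero h)
      omega
  rw [initialDegreePart]
  congr 1
  ext p
  constructor
  · rintro ⟨a, ha, rfl, hp⟩
    obtain ⟨f, hf, hf0, hle⟩ := (hmem a).1 hp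
    rw [hdeg f hf hf0] at ha
    have hfa : m.degree f = a := by
      obtain ⟨b, hb⟩ := exists_add_of_le hle
      have h1 : a.degree = (m.degree f).degree + b.degree := by rw [hb, map_add]
      have h2 := hlow f hf hf0
      have : b = 0 := (Finsupp.degree_eq_zero_iff _).1 (by omega)
      rw [hb, this, add_zero]
    -- `f` may be inhomogeneous; its component of degree `d` is a form with the same leading
    -- exponent.
    have hca : (homogeneousComponent d f).coeff a ≠ 0 := by
      rw [coeff_homogeneousComponent, if_pos ha, ← hfa]
      exact m.coeff_degree_ne_zero_iff.2 hf0
    refine ⟨a, ⟨homogeneousComponent d f,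
      (coeff_eq_zero_and_homogeneousComponent_mem hG hf).2, ?_,
      homogeneousComponent_isHomogeneous d f, ?_⟩, rfl⟩
    · rintro h
      exact hca (by rw [h, coeff_zero])
    · refine m.toSyn.injective (le_antisymm ?_ (m.le_degree (mem_support_iff.2 hca)))
      rw [m.degree_le_iff]
      intro b hb
      rw [← hfa]
      refine m.le_degree (mem_support_iff.2 fun h => mem_support_iff.1 hb ?_)
      rw [coeff_homogeneousComponent, h, ite_self]
  · rintro ⟨a, ha, rfl⟩
    have had := degree_eq_of_mem_leadingExponents ha
    obtain ⟨f, hf, hf0, -, hfa⟩ := ha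
    exact ⟨a, had.trans (hdeg f hf hf0).symm, rfl, (hmem a).2 ⟨f, hf, hf0, hfa.le⟩⟩

/-- An equigenerated monomial ideal is generated by its leading monomials of least degree. -/
theorem initialDegreePart_of_isMonomialIdeal (m : MonomialOrder (Fin n))
    {I : Ideal (MvPolynomial (Fin n) K)} (hI : IsEquigenerated I) (hmon : IsMonomialIdeal I) :
    initialDegreePart m I = I := by
  obtain ⟨d, G, hG, rfl⟩ := hI
  obtain ⟨B, hB⟩ := hmon
  have hsupp : ∀ f ∈ Ideal.span G, ∀ a ∈ f.support, monomial a (1 : K) ∈ Ideal.span G := by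
    classical
    intro f hf a ha
    rw [hB, mem_ideal_span_monomial_image] at hf ⊢
    intro b hb
    rw [support_monomial, if_neg one_ne_zero, Finset.mem_singleton] at hb
    exact hb ▸ hf a ha
  rw [initialDegreePart_span m hG]
  refine le_antisymm (Ideal.span_le.2 ?_) (Ideal.span_le.2 fun f hf => ?_)
  · rintro _ ⟨_, ⟨f, hf, hf0, -, rfl⟩, rfl⟩
    exact hsupp f hf _ (m.degree_mem_support hf0)
  · rw [SetLike.mem_coe, mem_ideal_span_monomial_image]
    intro a ha
    have had : a.degree = d := by
      by_contra h
      exact mem_support_iff.1 ha ((hG f hf).coeff_eq_zero h)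
    refine ⟨a, ⟨monomial a 1, hsupp f (Ideal.subset_span hf) a ha, ?_,
      isHomogeneous_monomial _ had, ?_⟩, le_rfl⟩
    · exact monomial_eq_zero.not.2 one_ne_zero
    · classical
      rw [m.degree_monomial, if_neg one_ne_zero]

/-! ### The fiber ring of a monomial ideal. -/

/-- Taking the constant term in `t` and then in the `xᵢ` kills `𝔪`. Nontriviality keeps the analytic
spread from being `⊥`. -/
instance nontrivial_fiber (I : Ideal (MvPolynomial (Fin n) K)) : Nontrivial (Fiber I) := by
  refine Ideal.Quotient.nontrivial_iff.2 fun htop => ?_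
  let φ : reesAlgebra I →+* K := (constantCoeff.comp
    (Polynomial.constantCoeff (R := MvPolynomial (Fin n) K))).comp (reesAlgebra I).val.toRingHom
  have hker : (gradedMaximalIdeal K n).map
      (algebraMap (MvPolynomial (Fin n) K) (reesAlgebra I)) ≤ RingHom.ker φ := by
    rw [gradedMaximalIdeal, Ideal.map_span, Ideal.span_le]
    rintro _ ⟨_, ⟨i, rfl⟩, rfl⟩
    simp [φ, RingHom.mem_ker]
  exact RingHom.ker_ne_top φ (top_le_iff.1 (htop ▸ hker))

/-- The class of `f t` in the fiber ring. -/
noncomputable def fiberOfMem {I : Ideal (MvPolynomial (Fin n) K)} {f : MvPolynomial (Fin n) K}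
    (hf : f ∈ I) : Fiber I :=
  Ideal.Quotient.mk _ (⟨Polynomial.monomial 1 f,
    reesAlgebra.monomial_mem.2 (by rwa [pow_one])⟩ : reesAlgebra I)

/-- In the fiber ring, a polynomial equals its constant term. -/
theorem mk_algebraMap_eq (I : Ideal (MvPolynomial (Fin n) K)) (p : MvPolynomial (Fin n) K) :
    (Ideal.Quotient.mk _ (algebraMap _ (reesAlgebra I) p) : Fiber I) =
      algebraMap K (Fiber I) (constantCoeff p) := by
  have hC : algebraMap K (Fiber I) (constantCoeff p) =
      Ideal.Quotient.mk _ (algebraMap (MvPolynomial (Fin n) K) (reesAlgebra I)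
        (C (constantCoeff p))) := rfl
  rw [hC, Ideal.Quotient.eq, ← map_sub]
  refine Ideal.mem_map_of_mem _ ?_
  rw [gradedMaximalIdeal, ← Set.image_univ, mem_ideal_span_X_image]
  intro a ha
  have ha0 : a ≠ 0 := by
    rintro rfl
    rw [mem_support_iff, coeff_sub, coeff_zero_C, constantCoeff_eq, sub_self] at ha
    exact ha rfl
  obtain ⟨i, hi⟩ := Finsupp.ne_iff.1 ha0
  exact ⟨i, Set.mem_univ i, hi⟩

/-- The fiber ring of an ideal is generated as a `K`-algebra by the generators of the ideal. -/
theorem adjoin_fiberOfMem_eq_top {ι : Type*} (g : ι → MvPolynomial (Fin n) K) :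
    Algebra.adjoin K (Set.range fun i =>
      fiberOfMem (Ideal.subset_span (Set.mem_range_self i) : g i ∈ Ideal.span (Set.range g))) =
      ⊤ := by
  set I := Ideal.span (Set.range g) with hI
  set T := Algebra.adjoin K (Set.range fun i =>
      fiberOfMem (Ideal.subset_span (Set.mem_range_self i) : g i ∈ Ideal.span (Set.range g)))
  have hscal : ∀ p : MvPolynomial (Fin n) K,
      (Ideal.Quotient.mk _ (algebraMap _ (reesAlgebra I) p) : Fiber I) ∈ T := fun p => by
    rw [mk_algebraMap_eq]
    exact T.algebraMap_mem _
  have hgen : ∀ (f : MvPolynomial (Fin n) K) (hf : f ∈ I), fiberOfMem hf ∈ T := by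
    intro f hf
    induction hf using Submodule.span_induction with
    | mem f hf =>
      obtain ⟨i, rfl⟩ := hf
      exact Algebra.subset_adjoin ⟨i, rfl⟩
    | zero =>
      convert T.zero_mem
      rw [fiberOfMem, ← map_zero (Ideal.Quotient.mk _)]
      congr 1
      exact Subtype.ext (by simp)
    | add f g hf hg ihf ihg =>
      convert T.add_mem ihf ihg
      rw [fiberOfMem, fiberOfMem, fiberOfMem, ← map_add]
      congr 1
      exact Subtype.ext (by simp)
    | smul c f hf ih =>
      convert T.mul_mem (hscal c) ih
      rw [fiberOfMem, fiberOfMem, ← map_mul]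
      congr 1
      exact Subtype.ext (by simp [Polynomial.C_mul_monomial])
  -- The Rees ring is generated over `S` by `It`, so scalars and classes of degree one suffice.
  have hall : ∀ (x : Polynomial (MvPolynomial (Fin n) K)) (hx : x ∈ Algebra.adjoin
      (MvPolynomial (Fin n) K) (Submodule.map (Polynomial.monomial 1 :
        MvPolynomial (Fin n) K →ₗ[MvPolynomial (Fin n) K] Polynomial _) I : Set (Polynomial _))),
      (Ideal.Quotient.mk _ (⟨x, adjoin_monomial_eq_reesAlgebra I ▸ hx⟩ : reesAlgebra I) :
        Fiber I) ∈ T := by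
    intro x hx
    induction hx using Algebra.adjoin_induction with
    | mem x hx =>
      obtain ⟨f, hf, rfl⟩ := hx
      exact hgen f hf
    | algebraMap p => exact hscal p
    | add x y hx hy ihx ihy => exact T.add_mem ihx ihy
    | mul x y hx hy ihx ihy => exact T.mul_mem ihx ihy
  refine top_le_iff.1 fun z _ => ?_
  obtain ⟨⟨x, hx⟩, rfl⟩ := Ideal.Quotient.mk_surjective z
  exact hall x ((adjoin_monomial_eq_reesAlgebra I).symm ▸ hx)

/-- The exponent vector of `x^a t`. -/
def homogenizedExponent (a : Fin n →₀ ℕ) : ℚ × (Fin n → ℚ) :=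
  (1, fun i => a i)

/-- The first coordinate counts the factors, that is, the power of `t`; together with
`prod_monomial_monomial` this makes a product of elements `x^a t` depend only on the sum of their
vectors. -/
theorem nsmul_sum_homogenizedExponent {ι : Type*} (e : ι → Fin n →₀ ℕ) (u : ι →₀ ℕ) :
    u.sum (fun i k => k • homogenizedExponent (e i)) =
      (((u.sum fun _ k => k : ℕ) : ℚ), fun j => ((u.sum fun i k => k • e i) j : ℚ)) := by
  refine Prod.ext ?_ (funext fun j => ?_)
  · simp [Finsupp.sum, Prod.fst_sum, homogenizedExponent]
  · simp [Finsupp.sum, Prod.snd_sum, homogenizedExponent, Finset.sum_apply,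
      Finsupp.finsetSum_apply]

theorem prod_monomial_monomial {ι : Type*} (e : ι → Fin n →₀ ℕ) (u : ι →₀ ℕ) :
    u.prod (fun i k => (Polynomial.monomial 1 (monomial (e i) (1 : K))) ^ k) =
      Polynomial.monomial (u.sum fun _ k => k) (monomial (u.sum fun i k => k • e i) (1 : K)) := by
  induction u using Finsupp.induction with
  | zero => simp
  | single_add i k u hi hk ih =>
    classical
    rw [Finsupp.prod_add_index' (by simp) (by simp [pow_add]), ih,
      Finsupp.sum_add_index' (by simp) (by simp),
      Finsupp.sum_add_index' (by simp) (by simp [add_smul])]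
    simp [Polynomial.monomial_pow, Polynomial.monomial_mul_monomial, monomial_pow, monomial_mul]

/-- The analytic spread of a monomial ideal generated by finitely many monomials is at most the
rank of the exponent vectors of the `x^a t`. -/
theorem analyticSpread_le_finrank {A : Set (Fin n →₀ ℕ)} (hA : A.Finite) :
    analyticSpread (Ideal.span ((fun a => monomial a (1 : K)) '' A)) ≤
      Module.finrank ℚ (Submodule.span ℚ (homogenizedExponent '' A)) := by
  have := hA.to_subtype
  have hrange : (fun a => monomial a (1 : K)) '' A =
      Set.range fun a : A => monomial (a : Fin n →₀ ℕ) (1 : K) := by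
    rw [Set.image_eq_range]
  rw [hrange, Set.image_eq_range, analyticSpread]
  refine ringKrullDim_le_finrank (K := K)
    (fun a : A => fiberOfMem (Ideal.subset_span (Set.mem_range_self a)))
    (fun a : A => homogenizedExponent (a : Fin n →₀ ℕ))
    (adjoin_fiberOfMem_eq_top fun a : A => monomial (a : Fin n →₀ ℕ) (1 : K)) fun u v huv => ?_
  rw [nsmul_sum_homogenizedExponent, nsmul_sum_homogenizedExponent] at huv
  obtain ⟨h1, h2⟩ := Prod.ext_iff.1 huv
  have h1' : (u.sum fun _ k => k) = v.sum fun _ k => k :=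
    Nat.cast_injective (R := ℚ) h1
  have h2' : (u.sum fun a k => k • (a : Fin n →₀ ℕ)) = v.sum fun a k => k • (a : Fin n →₀ ℕ) := by
    ext j
    exact Nat.cast_injective (R := ℚ) (congrFun h2 j)
  simp only [fiberOfMem, Finsupp.prod, ← map_pow, ← map_prod]
  congr 1
  refine Subtype.ext ?_
  have := (prod_monomial_monomial (K := K) (fun a : A => (a : Fin n →₀ ℕ)) u).trans
    ((congrArg₂ (fun k b => Polynomial.monomial k (monomial b (1 : K))) h1' h2').trans
      (prod_monomial_monomial (fun a : A => (a : Fin n →₀ ℕ)) v).symm)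
  simpa [Finsupp.prod] using this

/-! ### Assembly of the inequality. -/

open scoped Pointwise in
/-- Freiman's inequality for finite sets of exponents. -/
theorem finrank_mul_ncard_le (m : MonomialOrder (Fin n)) {A : Set (Fin n →₀ ℕ)} (hA : A.Finite) :
    Module.finrank ℚ (Submodule.span ℚ (homogenizedExponent '' A)) * A.ncard ≤
      (A + A).ncard +
        (Module.finrank ℚ (Submodule.span ℚ (homogenizedExponent '' A))).choose 2 := by
  classical
  lift A to Finset (Fin n →₀ ℕ) using hA
  -- Freiman's lemma needs an order compatible with addition; `m.syn` carries the monomial order.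
  have h := finrank_mul_card_le_card_add_self
    (fun a : m.syn => homogenizedExponent (m.toSyn.symm a)) (fun a b c e h => by
      have h' := congrArg m.toSyn.symm h
      rw [map_add, map_add] at h'
      refine Prod.ext rfl (funext fun i => ?_)
      have hi := DFunLike.congr_fun h' i
      simp only [Finsupp.add_apply] at hi
      simp only [homogenizedExponent, Prod.snd_add, Pi.add_apply]
      exact_mod_cast hi) (A.image m.toSyn)
  have himg : (fun a : m.syn => homogenizedExponent (m.toSyn.symm a)) ''
      ((A.image m.toSyn : Finset m.syn) : Set m.syn) = homogenizedExponent '' (A : Set _) := by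
    rw [Finset.coe_image, Set.image_image]
    simp
  rw [himg, ← Finset.image_add, Finset.card_image_of_injective _ m.toSyn.injective,
    Finset.card_image_of_injective _ m.toSyn.injective] at h
  rwa [← Finset.coe_add, Set.ncard_coe_finset, Set.ncard_coe_finset]

/-- The lower bound for the number of generators of the square in terms of the ideal of initial
monomials of least degree. -/
theorem exists_analyticSpread_initialDegreePart (m : MonomialOrder (Fin n))
    {I : Ideal (MvPolynomial (Fin n) K)} (hI : IsEquigenerated I) :
    ∃ l : ℕ, analyticSpread (initialDegreePart m I) = l ∧
      (mu (I ^ 2) : ℤ) ≥ (l : ℤ) * (mu I : ℤ) - (l.choose 2 : ℤ) := by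
  obtain ⟨d, G, hG, rfl⟩ := hI
  have hfin := finite_leadingExponents m (Ideal.span G) d
  have hmu := mu_le_ncard_leadingExponents m hG
  have hmu2 := ncard_leadingExponents_add_le_mu m hG
  rw [initialDegreePart_span m hG]
  generalize leadingExponents m (Ideal.span G) d = A at *
  have hdim := analyticSpread_le_finrank (K := K) hfin
  have hfreiman := finrank_mul_ncard_le m hfin
  have hrank : Module.finrank ℚ (Submodule.span ℚ (homogenizedExponent '' A)) ≤ A.ncard := by
    lift A to Finset (Fin n →₀ ℕ) using hfin
    classical
    rw [← Finset.coe_image, Set.ncard_coe_finset]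
    exact (finrank_span_finset_le_card _).trans Finset.card_image_le
  generalize Module.finrank ℚ (Submodule.span ℚ (homogenizedExponent '' A)) = r at *
  -- Nontriviality excludes `⊥` and the bound `r` excludes `⊤`.
  obtain ⟨l, hl⟩ : ∃ l : ℕ,
      analyticSpread (Ideal.span ((fun a => monomial a (1 : K)) '' A)) = l := by
    have h0 : (0 : WithBot ℕ∞) ≤
        analyticSpread (Ideal.span ((fun a => monomial a (1 : K)) '' A)) :=
      ringKrullDim_nonneg_of_nontrivial
    generalize analyticSpread (Ideal.span ((fun a => monomial a (1 : K)) '' A)) = x at *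
    cases x with
    | bot => simp at h0
    | coe x =>
      cases x with
      | top => exact absurd (WithBot.coe_le_coe.1 hdim) (by simp)
      | coe x => exact ⟨x, rfl⟩
  have hlr : l ≤ r := by
    rw [hl] at hdim
    exact_mod_cast hdim
  refine ⟨l, hl, ?_⟩
  have h1 := mul_add_choose_two_le hlr hrank
  have h2 : l * mu (Ideal.span G) ≤ l * A.ncard := Nat.mul_le_mul_left l hmu
  have h3 : l * mu (Ideal.span G) ≤ mu (Ideal.span G ^ 2) + l.choose 2 := by omega
  have h4 : (l : ℤ) * mu (Ideal.span G) ≤ mu (Ideal.span G ^ 2) + l.choose 2 := by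
    exact_mod_cast h3
  linarith

end FiberRing

theorem theorem1p9 {K : Type*} [Field K] {n : ℕ}
    (I : Ideal (MvPolynomial (Fin n) K)) (hI : FiberRing.IsEquigenerated I) :
    (∀ m : MonomialOrder (Fin n),
      ∃ l : ℕ, FiberRing.analyticSpread (FiberRing.initialDegreePart m I) = l ∧
        (FiberRing.mu (I ^ 2) : ℤ) ≥ (l : ℤ) * (FiberRing.mu I : ℤ) - (l.choose 2 : ℤ)) ∧
    (FiberRing.IsMonomialIdeal I →
      ∃ l : ℕ, FiberRing.analyticSpread I = l ∧
        (FiberRing.mu (I ^ 2) : ℤ) ≥ (l : ℤ) * (FiberRing.mu I : ℤ) - (l.choose 2 : ℤ)) := by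
  refine ⟨fun m => FiberRing.exists_analyticSpread_initialDegreePart m hI, fun hmon => ?_⟩
  -- Any monomial order would do, since `I' = I` for each.
  have h := FiberRing.exists_analyticSpread_initialDegreePart MonomialOrder.lex hI
  rwa [FiberRing.initialDegreePart_of_isMonomialIdeal _ hI hmon] at h
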